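/- For $m\ge 0$ let $$\Psi_m(q)=\sum_{k=0}^{m}(-1)^k(2k+1)\,q^{k(k+1)/2}\in\mathbb C[q],\qquad N_m=\frac{m(m+1)}2 .$$ Then $\deg\Psi_m=N_m$. For $m\ge1$ let $$\nu_m=\frac1{N_m}\sum_{\Psi_m(\alpha)=0}\delta_\alpha ,$$ where the zeros $\alpha\in\mathbb C$ are counted with multiplicity, as they are throughout. Then both of the following equivalent descriptions of the equidistribution of the zeros hold. (A) As $m\to\infty$, the measures $\nu_m$ converge weakly (tested against bounded continuous functions on $\mathbb C$) to the Haar measure $d\theta/2\pi$ of the unit circle $\mathbb T$, that is, for every bounded continuous $f:\mathbb C\to\mathbb R$, $$\int f\,d\nu_m\longrightarrow\frac1{2\pi}\int_0^{2\pi}f(e^{i\theta})\,d\theta .$$ (B) For every fixed arc $I=\{e^{i\theta}:\theta\in J\}\subset\mathbb T$, where $J$ is an interval with endpoints $a\le b\le a+2\pi$, each of which may or may not belong to $J$, $$\frac1{N_m}\#\{\alpha:\Psi_m(\alpha)=0,\ \alpha/|\alpha|\in I\}\longrightarrow\frac{b-a}{2\pi}\qquad(m\to\infty);$$ and for every fixed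 $\varepsilon>0$, all but $o(N_m)$ of the zeros of $\Psi_m$ satisfy $1-\varepsilon<|\alpha|<1+\varepsilon$. -/

import Mathlib

open Filter Topology MeasureTheory
open scoped NNReal ENNReal

noncomputable section

/-- The polynomial `Ψ_m(q) = ∑_{k=0}^m (-1)^k (2k+1) q^{k(k+1)/2}` over `ℂ`
(the division of the even number `k(k+1)` by `2` is exact). -/
def Psi (m : ℕ) : Polynomial ℂ :=
  ∑ k ∈ Finset.range (m + 1),
    Polynomial.C ((-1 : ℂ) ^ k * (2 * (k : ℂ) + 1)) * Polynomial.X ^ (k * (k + 1) / 2)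

/-- `N_m = m(m+1)/2`. -/
def zeroTotal (m : ℕ) : ℕ := m * (m + 1) / 2

/-- The number of zeros of `Ψ_m` in the set `S`, counted with multiplicity. -/
def zeroCount (m : ℕ) (S : Set ℂ) : ℕ := by
  classical exact (Psi m).roots.countP (fun α => α ∈ S)

/-- The Dirac measure at `α`, as a finite measure. -/
def diracFinite (α : ℂ) : FiniteMeasure ℂ := ⟨Measure.dirac α, inferInstance⟩

/-- The normalized zero-counting measure `ν_m = N_m⁻¹ ∑ δ_α`, the sum running over the zeros `α`
of `Ψ_m` with multiplicity (for `m = 0` there are no zeros and this is the zero measure). -/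
def zeroMeasure (m : ℕ) : FiniteMeasure ℂ :=
  (zeroTotal m : ℝ≥0)⁻¹ • ((Psi m).roots.map diracFinite).sum

/-- The arc length measure `dθ` of the unit circle, as a measure on `ℂ`: the image of Lebesgue
measure on `(0, 2π]` under `θ ↦ exp (iθ)`. -/
def circleArcLength : FiniteMeasure ℂ :=
  ⟨(volume.restrict (Set.Ioc 0 (2 * Real.pi))).map
    (fun θ : ℝ => Complex.exp ((θ : ℂ) * Complex.I)), inferInstance⟩

/-- The normalized Haar measure `dθ / 2π` of the unit circle, as a measure on `ℂ`. -/
def circleHaar : FiniteMeasure ℂ := (2 * NNReal.pi)⁻¹ • circleArcLength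

/-- The set of nonzero complex numbers having an argument in `J`:
the points `r exp (iθ)` with `r > 0` and `θ ∈ J`. -/
def sector (J : Set ℝ) : Set ℂ :=
  {α | ∃ r : ℝ, 0 < r ∧ ∃ θ ∈ J, α = (r : ℂ) * Complex.exp ((θ : ℂ) * Complex.I)}

/-- The open annulus `1 - ε < |α| < 1 + ε`. -/
def annulusAroundCircle (ε : ℝ) : Set ℂ := {α | 1 - ε < ‖α‖ ∧ ‖α‖ < 1 + ε}

end

/-! Only three properties of `Psi m` matter: its constant coefficient is 1, its coefficient of
degree j has modulus at most 2j + 1 whatever m is, and its leading coefficient has modulus at least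
1. Write N for the degree and M for the Mahler measure.

Radii: Jensen's formula and the product of the zeros give ∑ |log|α|| = 2 log M - log|leading
coefficient| = O(log N) (`sum_abs_log_norm_roots_le`), so only O(log N) zeros avoid a fixed annulus
around the circle.

Angles: by Newton's identities ∑ α⁻ᵏ, k ≥ 1, depends only on the coefficients of degree at most k,
so it is bounded independently of m (`exists_norm_sum_inv_roots_pow_le`). Divided by N, these Weyl
sums tend to 0. Since the zeros concentrate at the circle and stay away from 0, Weyl's criterion
(`tendsto_sum_div_card_of_inv_power_sums`) gives weak convergence. Arcs follow from the portmanteau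
theorem, the boundary of a sector being null for the limit. -/

/-! ### Newton's identities and inverse power sums -/

open Polynomial in
/-- Newton's identities in generating function form: the logarithmic derivative of
`∏ (1 - β X)` is `-∑ₖ (∑ β ^ (k + 1)) X ^ k`. -/
theorem derivative_prod_one_sub_C_mul_X (s : Multiset ℂ) :
    ((derivative (s.map fun β => (1 - C β * X : ℂ[X])).prod : ℂ[X]) : PowerSeries ℂ) =
      -(((s.map fun β => (1 - C β * X : ℂ[X])).prod : ℂ[X]) : PowerSeries ℂ) *
        PowerSeries.mk fun k => (s.map fun β => β ^ (k + 1)).sum := by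
  induction s using Multiset.induction_on with
  | empty =>
    have : (PowerSeries.mk fun _ => 0 : PowerSeries ℂ) = 0 := by ext; simp
    simp [this]
  | cons b s ih =>
    have hsplit : (PowerSeries.mk fun k => ((b ::ₘ s).map fun β => β ^ (k + 1)).sum) =
        PowerSeries.mk (fun k => b ^ (k + 1)) +
          PowerSeries.mk fun k => (s.map fun β => β ^ (k + 1)).sum := by
      ext; simp
    have hgeom : (1 - PowerSeries.C b * PowerSeries.X) * PowerSeries.mk (fun k => b ^ (k + 1)) =
        PowerSeries.C b := by
      ext n
      rw [sub_mul, one_mul, mul_assoc, map_sub, PowerSeries.coeff_C_mul]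
      cases n with
      | zero => simp
      | succ n => simp [PowerSeries.coeff_succ_X_mul]; ring
    rw [hsplit, Multiset.map_cons, Multiset.prod_cons, derivative_mul, coe_add, coe_mul, coe_mul,
      ih]
    simp only [derivative_sub, derivative_one, derivative_C_mul, derivative_X, coe_sub, coe_one,
      coe_mul, coe_C, coe_X, mul_one, zero_sub, coe_neg]
    linear_combination (-(((s.map fun β => (1 - C β * X : ℂ[X])).prod : ℂ[X]) :
      PowerSeries ℂ)) * (-hgeom)

open Polynomial in
theorem eq_prod_one_sub_C_inv_mul_X {P : ℂ[X]} (h0 : P.coeff 0 = 1) :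
    P = ((P.roots.map (·⁻¹)).map fun β => (1 - C β * X : ℂ[X])).prod := by
  have hne : ∀ α ∈ P.roots, α ≠ 0 := by
    rintro α hα rfl
    have := (mem_roots'.1 hα).2
    rw [IsRoot, ← coeff_zero_eq_eval_zero, h0] at this
    exact one_ne_zero this
  have hfac := (IsAlgClosed.splits P).eq_prod_roots
  have hlin : (P.roots.map fun α => (X - C α : ℂ[X])) =
      P.roots.map fun α => C (-α) * (1 - C α⁻¹ * X) := by
    refine Multiset.map_congr rfl fun α hα => ?_
    have : C α * C α⁻¹ = (1 : ℂ[X]) := by rw [← C_mul, mul_inv_cancel₀ (hne α hα), C_1]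
    rw [C_neg]
    linear_combination (-X : ℂ[X]) * this
  have hc : C P.leadingCoeff * (P.roots.map fun α => C (-α)).prod = (1 : ℂ[X]) := by
    have h := (IsAlgClosed.splits P).coeff_zero_eq_leadingCoeff_mul_prod_roots
    rw [show (P.roots.map fun α => C (-α)) = (P.roots.map fun α => -α).map C by
      rw [Multiset.map_map]; rfl, ← map_multiset_prod, ← C_mul, ← C_1]
    congr 1
    rw [← h0, coeff_zero_eq_eval_zero]
    nth_rw 3 [hfac]
    simp [eval_multiset_prod, Multiset.map_map]
  rw [hlin, Multiset.prod_map_mul, ← mul_assoc, hc, one_mul] at hfac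
  rwa [Multiset.map_map]

open Polynomial in
/-- The power sums of the inverses of the zeros are controlled by the low coefficients. -/
theorem exists_norm_sum_inv_roots_pow_le (B : ℕ → ℝ) (k : ℕ) :
    ∃ K : ℝ, ∀ P : ℂ[X], P.coeff 0 = 1 → (∀ j, ‖P.coeff j‖ ≤ B j) →
      ‖(P.roots.map fun α => α⁻¹ ^ (k + 1)).sum‖ ≤ K := by
  induction k using Nat.strong_induction_on with
  | _ k ih =>
  choose! K hK using ih
  refine ⟨B (k + 1) * (k + 1) + ∑ i ∈ Finset.range k, B (k - i) * K i, fun P h0 hB => ?_⟩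
  have hN := derivative_prod_one_sub_C_mul_X (P.roots.map (·⁻¹))
  rw [← eq_prod_one_sub_C_inv_mul_X h0] at hN
  have hk := congrArg (PowerSeries.coeff k) hN
  rw [neg_mul, map_neg, PowerSeries.coeff_mul, coeff_coe, coeff_derivative,
    Finset.Nat.sum_antidiagonal_eq_sum_range_succ_mk] at hk
  -- The last term of the reflected sum carries `P.coeff 0 = 1`, so the power sum of highest order
  -- can be solved for.
  rw [← Finset.sum_range_reflect, Finset.sum_range_succ] at hk
  simp only [coeff_coe, PowerSeries.coeff_mk, Multiset.map_map, Function.comp_def,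
    Nat.succ_eq_add_one, Nat.add_sub_cancel, Nat.sub_self, h0, one_mul, Nat.sub_zero] at hk
  have heq : (P.roots.map fun α => α⁻¹ ^ (k + 1)).sum = -(P.coeff (k + 1) * (k + 1)) -
      ∑ i ∈ Finset.range k, P.coeff (k - i) * (P.roots.map fun α => α⁻¹ ^ (i + 1)).sum := by
    have hsum : ∑ i ∈ Finset.range k, P.coeff (k - i) *
          (P.roots.map fun α => α⁻¹ ^ (k - (k - i) + 1)).sum =
        ∑ i ∈ Finset.range k, P.coeff (k - i) * (P.roots.map fun α => α⁻¹ ^ (i + 1)).sum := by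
      refine Finset.sum_congr rfl fun i hi => ?_
      rw [Nat.sub_sub_self (Finset.mem_range.1 hi).le]
    rw [hk, ← hsum]
    ring
  rw [heq]
  refine (norm_sub_le _ _).trans (add_le_add ?_ ?_)
  · rw [norm_neg, norm_mul]
    have : ‖(k + 1 : ℂ)‖ = k + 1 := by
      rw [← Nat.cast_one, ← Nat.cast_add, Complex.norm_natCast]; push_cast; rfl
    rw [this]
    exact mul_le_mul_of_nonneg_right (hB _) (by positivity)
  · refine norm_sum_le_of_le _ fun i hi => ?_
    rw [norm_mul]
    exact mul_le_mul (hB _) (hK i (Finset.mem_range.1 hi) P h0 hB) (norm_nonneg _)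
      ((norm_nonneg _).trans (hB _))

/-! ### Moduli of the zeros -/

-- If |α| < 1/9, then 2j + 1 ≤ 3ʲ bounds the nonconstant terms by 3⁻ʲ; their sum is at most 1/2 and
-- cannot cancel the constant term 1.
open Polynomial in
theorem norm_root_ge_of_coeff_bound {P : ℂ[X]} (h0 : P.coeff 0 = 1)
    (hB : ∀ j, ‖P.coeff j‖ ≤ 2 * j + 1) {α : ℂ} (hα : α ∈ P.roots) : 1 / 9 ≤ ‖α‖ := by
  by_contra! hlt
  have hroot : P.eval α = 0 := (mem_roots'.1 hα).2
  rw [eval_eq_sum_range, Finset.sum_range_succ', h0, pow_zero, mul_one] at hroot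
  have hterm : ∀ j ∈ Finset.range P.natDegree, ‖P.coeff (j + 1) * α ^ (j + 1)‖ ≤
      (1 / 3) * (1 / 3 : ℝ) ^ j := by
    intro j _
    have h3 : (2 * ((j + 1 : ℕ) : ℝ) + 1) ≤ 3 ^ (j + 1) := by
      have := one_add_mul_le_pow (a := (2 : ℝ)) (by norm_num) (j + 1)
      norm_num at this ⊢
      linarith
    calc ‖P.coeff (j + 1) * α ^ (j + 1)‖ ≤ 3 ^ (j + 1) * (1 / 9) ^ (j + 1) := by
          rw [norm_mul, norm_pow]
          gcongr
          exact (hB _).trans h3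
      _ = (1 / 3) * (1 / 3 : ℝ) ^ j := by
          rw [← mul_pow, pow_succ]; norm_num; ring
  have hsum := norm_sum_le_of_le _ hterm
  rw [eq_neg_of_add_eq_zero_left hroot, norm_neg, norm_one, ← Finset.mul_sum] at hsum
  have hg : ∑ j ∈ Finset.range P.natDegree, (1 / 3 : ℝ) ^ j ≤ 3 / 2 := by
    rw [geom_sum_eq (by norm_num), div_le_iff_of_neg (by norm_num)]
    have : (0 : ℝ) < (1 / 3) ^ P.natDegree := by positivity
    linarith
  linarith

-- Jensen's formula controls the sum of log⁺|α|, and the constant coefficient 1 ties the sum of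
-- log|α| to the leading coefficient; together they control both signs of log|α|.
open Polynomial in
theorem sum_abs_log_norm_roots_le {P : ℂ[X]} (h0 : P.coeff 0 = 1)
    (hB : ∀ j, ‖P.coeff j‖ ≤ 2 * j + 1) (hlc : 1 ≤ ‖P.leadingCoeff‖) :
    (P.roots.map fun α => |Real.log ‖α‖|).sum ≤ 4 * Real.log (2 * P.natDegree + 1) := by
  have hPne : P ≠ 0 := by rintro rfl; simp at h0
  have hM := logMahlerMeasure_eq_log_leadingCoeff_add_sum_log_roots P
  have hroots : ∀ α ∈ P.roots, ‖α‖ ≠ 0 := fun α hα => by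
    have := norm_root_ge_of_coeff_bound h0 hB hα
    linarith
  have hconst : Real.log ‖P.leadingCoeff‖ + (P.roots.map fun α => Real.log ‖α‖).sum = 0 := by
    have h := (IsAlgClosed.splits P).coeff_zero_eq_leadingCoeff_mul_prod_roots
    have h' := congrArg (fun z : ℂ => Real.log ‖z‖) h
    simp only [h0, norm_mul, norm_pow, norm_neg, norm_one, one_pow, one_mul, Real.log_one] at h'
    have hnp : ‖P.roots.prod‖ = (P.roots.map fun α => ‖α‖).prod :=
      map_multiset_prod (normHom : ℂ →*₀ ℝ) _
    rw [hnp, Real.log_mul (by linarith) (by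
      rw [Ne, Multiset.prod_eq_zero_iff, Multiset.mem_map]
      rintro ⟨α, hα, h⟩
      exact hroots α hα h), Real.log_multiset_prod (by
      intro x hx
      obtain ⟨α, hα, rfl⟩ := Multiset.mem_map.1 hx
      exact hroots α hα), Multiset.map_map] at h'
    exact h'.symm
  -- Termwise |x| = 2 max(0, x) - x.
  have habs : (P.roots.map fun α => |Real.log ‖α‖|).sum =
      2 * (P.roots.map fun α => Real.posLog ‖α‖).sum -
        (P.roots.map fun α => Real.log ‖α‖).sum := by
    rw [← Multiset.sum_map_mul_left, ← Multiset.sum_map_sub]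
    congr 1
    refine Multiset.map_congr rfl fun α _ => ?_
    rw [Real.posLog]
    rcases le_total 0 (Real.log ‖α‖) with h | h
    · rw [abs_of_nonneg h, max_eq_right h]; ring
    · rw [abs_of_nonpos h, max_eq_left h]; ring
  -- There are N + 1 coefficients, each of modulus at most 2N + 1.
  have hsum : P.mahlerMeasure ≤ (2 * P.natDegree + 1) ^ 2 := by
    refine (mahlerMeasure_le_sum_norm_coeff P).trans ?_
    rw [sum_over_range _ (by simp)]
    refine (Finset.sum_le_card_nsmul _ _ (2 * P.natDegree + 1 : ℝ) fun j hj => ?_).trans ?_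
    · have : (j : ℝ) ≤ P.natDegree := by
        exact_mod_cast Nat.lt_succ_iff.1 (Finset.mem_range.1 hj)
      linarith [hB j]
    · rw [Finset.card_range, nsmul_eq_mul]
      push_cast
      nlinarith [Nat.cast_nonneg (α := ℝ) P.natDegree]
  have hlog := Real.log_le_log (mahlerMeasure_pos_of_ne_zero hPne) hsum
  rw [← logMahlerMeasure_eq_log_MahlerMeasure, Real.log_pow, hM] at hlog
  have := Real.log_nonneg hlc
  push_cast at hlog
  rw [habs]
  linarith

open Polynomial in
/-- The number of zeros off a fixed annulus around the unit circle is logarithmic in the degree. -/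
theorem countP_roots_compl_annulus_mul_log_le {P : ℂ[X]} (h0 : P.coeff 0 = 1)
    (hB : ∀ j, ‖P.coeff j‖ ≤ 2 * j + 1) (hlc : 1 ≤ ‖P.leadingCoeff‖) {ε : ℝ} (hε : 0 < ε)
    [DecidablePred (· ∈ (annulusAroundCircle ε)ᶜ)] :
    (P.roots.countP (· ∈ (annulusAroundCircle ε)ᶜ) : ℝ) * Real.log (1 + ε) ≤
      4 * Real.log (2 * P.natDegree + 1) := by
  refine le_trans ?_ (sum_abs_log_norm_roots_le h0 hB hlc)
  rw [Multiset.countP_eq_card_filter, ← nsmul_eq_mul]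
  calc _ ≤ ((P.roots.filter (· ∈ (annulusAroundCircle ε)ᶜ)).map fun α => |Real.log ‖α‖|).sum := by
        rw [← Multiset.card_map (fun α : ℂ => |Real.log ‖α‖|)]
        refine Multiset.card_nsmul_le_sum fun x hx => ?_
        obtain ⟨α, hα, rfl⟩ := Multiset.mem_map.1 hx
        obtain ⟨hα, hann⟩ := Multiset.mem_filter.1 hα
        have hpos : 0 < ‖α‖ := by linarith [norm_root_ge_of_coeff_bound h0 hB hα]
        by_cases h : 1 + ε ≤ ‖α‖
        · exact (Real.log_le_log (by linarith) h).trans (le_abs_self _)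
        · have h' : ‖α‖ ≤ 1 - ε := by
            by_contra! h'
            exact hann ⟨h', not_le.1 h⟩
          -- Inside the circle |α|⁻¹ ≥ 1 + ε, because (1 - ε)(1 + ε) ≤ 1.
          refine le_trans ?_ (neg_le_abs _)
          rw [← Real.log_inv]
          refine Real.log_le_log (by linarith) ?_
          rw [le_inv_comm₀ (by linarith) hpos]
          refine h'.trans ?_
          rw [← one_div, le_div_iff₀ (by linarith)]
          nlinarith
    _ ≤ _ := by
        conv_rhs => rw [← Multiset.filter_add_not (· ∈ (annulusAroundCircle ε)ᶜ) P.roots]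
        rw [Multiset.map_add, Multiset.sum_add]
        refine le_add_of_nonneg_right (Multiset.sum_nonneg fun x hx => ?_)
        obtain ⟨α, _, rfl⟩ := Multiset.mem_map.1 hx
        exact abs_nonneg _

/-! ### Arc length and Haar measure on the circle -/

instance fact_two_pi_pos : Fact (0 < 2 * Real.pi) := ⟨Real.two_pi_pos⟩

theorem circleArcLength_eq_map_volume :
    (circleArcLength : Measure ℂ) =
      (volume : Measure (AddCircle (2 * Real.pi))).map fun x => (AddCircle.toCircle x : ℂ) := by
  have hmeas : Measurable fun x : AddCircle (2 * Real.pi) => (AddCircle.toCircle x : ℂ) :=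
    (continuous_subtype_val.comp AddCircle.continuous_toCircle).measurable
  have h := AddCircle.measurePreserving_mk (2 * Real.pi) 0
  rw [← h.map_eq, Measure.map_map hmeas h.measurable, zero_add]
  change (volume.restrict (Set.Ioc 0 (2 * Real.pi))).map _ = _
  congr 1
  funext θ
  rw [Function.comp_apply, AddCircle.toCircle_apply_mk, div_self Real.two_pi_pos.ne', one_mul,
    Circle.coe_exp]

/-- Any interval of length 2π is a fundamental domain; an arc can thus be measured from its own left
endpoint. -/
theorem circleArcLength_eq_map_restrict (t : ℝ) :
    (circleArcLength : Measure ℂ) =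
      (volume.restrict (Set.Ioc t (t + 2 * Real.pi))).map
        fun θ : ℝ => Complex.exp ((θ : ℂ) * Complex.I) := by
  have hmeas : Measurable fun x : AddCircle (2 * Real.pi) => (AddCircle.toCircle x : ℂ) :=
    (continuous_subtype_val.comp AddCircle.continuous_toCircle).measurable
  have h := AddCircle.measurePreserving_mk (2 * Real.pi) t
  rw [circleArcLength_eq_map_volume, ← h.map_eq, Measure.map_map hmeas h.measurable]
  congr 1
  funext θ
  rw [Function.comp_apply, AddCircle.toCircle_apply_mk, div_self Real.two_pi_pos.ne', one_mul,
    Circle.coe_exp]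

theorem toMeasure_circleHaar :
    (circleHaar : Measure ℂ) = ENNReal.ofReal (2 * Real.pi)⁻¹ • (circleArcLength : Measure ℂ) := by
  have : ((2 * NNReal.pi)⁻¹ : ℝ≥0) = Real.toNNReal (2 * Real.pi)⁻¹ := by
    ext
    rw [Real.coe_toNNReal _ (inv_nonneg.2 Real.two_pi_pos.le)]
    simp
  rw [circleHaar, FiniteMeasure.toMeasure_smul, this]
  rfl

theorem integral_circleHaar {f : ℂ → ℝ} (hf : Continuous f) :
    ∫ z, f z ∂(circleHaar : Measure ℂ) =
      ∫ x : AddCircle (2 * Real.pi), f (AddCircle.toCircle x) ∂AddCircle.haarAddCircle := by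
  have hmeas : Measurable fun x : AddCircle (2 * Real.pi) => (AddCircle.toCircle x : ℂ) :=
    (continuous_subtype_val.comp AddCircle.continuous_toCircle).measurable
  rw [toMeasure_circleHaar, integral_smul_measure, circleArcLength_eq_map_volume,
    integral_map hmeas.aemeasurable hf.aestronglyMeasurable, AddCircle.integral_haarAddCircle,
    ENNReal.toReal_ofReal (inv_nonneg.2 Real.two_pi_pos.le)]

theorem exists_toCircle_eq {z : ℂ} (hz : ‖z‖ = 1) :
    ∃ x : AddCircle (2 * Real.pi), (AddCircle.toCircle x : ℂ) = z := by
  refine ⟨(z.arg : ℝ), ?_⟩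
  rw [AddCircle.toCircle_apply_mk, div_self Real.two_pi_pos.ne', one_mul, Circle.coe_exp]
  simpa [hz] using Complex.norm_mul_exp_arg_mul_I z

/-! ### Weyl's criterion near the unit circle -/

section Equidistribution

variable {R : ℕ → Multiset ℂ} {c : ℝ}

open Classical in
/-- A function that is small on the unit circle has small averages over point sets that
concentrate near the circle. -/
theorem eventually_norm_sum_le_of_small_on_circle (hc : 0 < c)
    (hR : ∀ m, ∀ α ∈ R m, c ≤ ‖α‖)
    (hann : ∀ ε : ℝ, 0 < ε → (fun m => ((R m).countP (· ∈ (annulusAroundCircle ε)ᶜ) : ℝ))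
      =o[atTop] fun m => ((R m).card : ℝ))
    {f : ℂ → ℂ} (hf : ContinuousOn f {0}ᶜ) {B : ℝ} (hB : ∀ α, c ≤ ‖α‖ → ‖f α‖ ≤ B)
    {δ : ℝ} (hδ : 0 < δ) (hsmall : ∀ z, ‖z‖ = 1 → ‖f z‖ < δ) :
    ∀ᶠ m in atTop, ‖((R m).map f).sum‖ ≤ 2 * δ * (R m).card := by
  have hU : IsOpen ({0}ᶜ ∩ (fun z => ‖f z‖) ⁻¹' Set.Iio δ) :=
    hf.norm.isOpen_inter_preimage isOpen_compl_singleton isOpen_Iio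
  obtain ⟨ε, hε, hthick⟩ := (isCompact_sphere (0 : ℂ) 1).exists_thickening_subset_open hU
    (fun z hz => by
      have hz : ‖z‖ = 1 := by simpa using hz
      refine ⟨?_, hsmall z hz⟩
      rintro rfl
      simp at hz)
  -- Chosen so that the points off the annulus, each contributing at most |B|, add at most δ times
  -- the cardinality.
  have hann' := (hann ε hε).def (c := δ / (|B| + 1)) (by positivity)
  filter_upwards [hann'] with m hm
  rw [Real.norm_of_nonneg (by positivity), Real.norm_of_nonneg (by positivity)] at hm
  have hterm : ∀ α ∈ R m, ‖f α‖ ≤ δ + |B| * if α ∈ (annulusAroundCircle ε)ᶜ then 1 else 0 := by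
    intro α hα
    have hpos : 0 < ‖α‖ := hc.trans_le (hR m α hα)
    split_ifs with h
    · have := (hB α (hR m α hα)).trans (le_abs_self B)
      linarith
    · have hmem : α ∈ annulusAroundCircle ε := not_not.1 h
      have hαt : α ∈ Metric.thickening ε (Metric.sphere (0 : ℂ) 1) := by
        -- The radial projection of α lies at distance | |α| - 1 |.
        refine Metric.mem_thickening_iff.2 ⟨α / ‖α‖, by simp [hpos.ne'], ?_⟩
        have hα0 : (‖α‖ : ℂ) ≠ 0 := by exact_mod_cast hpos.ne'
        have heq : α - α / ‖α‖ = (α / ‖α‖) * ((‖α‖ - 1 : ℝ) : ℂ) := by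
          push_cast
          field_simp
        rw [dist_eq_norm, heq, norm_mul, norm_div, Complex.norm_real, Complex.norm_real, norm_norm,
          div_self hpos.ne', one_mul, Real.norm_eq_abs, abs_lt]
        exact ⟨by linarith [hmem.1], by linarith [hmem.2]⟩
      have : ‖f α‖ < δ := (hthick hαt).2
      linarith
  calc ‖((R m).map f).sum‖ ≤ ((R m).map fun α => ‖f α‖).sum := by
        simpa [Multiset.map_map, Function.comp_def] using norm_multiset_sum_le ((R m).map f)
    _ ≤ ((R m).map fun α => δ + |B| * if α ∈ (annulusAroundCircle ε)ᶜ then 1 else 0).sum :=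
        Multiset.sum_map_le_sum_map _ _ hterm
    _ = (R m).card * δ + |B| * (R m).countP (· ∈ (annulusAroundCircle ε)ᶜ) := by
        have hcount : ∀ s : Multiset ℂ,
            (s.map fun α => if α ∈ (annulusAroundCircle ε)ᶜ then (1 : ℝ) else 0).sum =
              s.countP (· ∈ (annulusAroundCircle ε)ᶜ) := by
          intro s
          induction s using Multiset.induction_on with
          | empty => simp
          | cons a s ih =>
            rw [Multiset.map_cons, Multiset.sum_cons, ih, Multiset.countP_cons]
            push_cast
            ring
        rw [Multiset.sum_map_add, Multiset.sum_map_mul_left, hcount]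
        simp
    _ ≤ (R m).card * δ + |B| * (δ / (|B| + 1) * (R m).card) := by gcongr
    _ ≤ 2 * δ * (R m).card := by
        have h1 : |B| * (δ / (|B| + 1)) ≤ δ := by
          rw [← mul_div_assoc, div_le_iff₀ (by positivity)]
          nlinarith [abs_nonneg B]
        nlinarith [Nat.cast_nonneg (α := ℝ) (R m).card]

/-- Every trigonometric polynomial extends to the punctured plane, boundedly away from `0`, so that
its averages over point sets with negligible inverse power sums converge. -/
theorem exists_extension_of_mem_span_fourier (hc : 0 < c)
    (hcard : ∀ᶠ m in atTop, (R m).card ≠ 0)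
    (hpow : ∀ k : ℕ, (fun m => ((R m).map fun α => α⁻¹ ^ (k + 1)).sum)
      =o[atTop] fun m => ((R m).card : ℝ))
    {g : C(AddCircle (2 * Real.pi), ℂ)}
    (hg : g ∈ Submodule.span ℂ (Set.range (@fourier (2 * Real.pi)))) :
    ∃ h : ℂ → ℂ, ContinuousOn h {0}ᶜ ∧ (∃ B, ∀ α, c ≤ ‖α‖ → ‖h α‖ ≤ B) ∧
      (∀ x : AddCircle (2 * Real.pi), h (AddCircle.toCircle x) = g x) ∧
      Tendsto (fun m => ((R m).map h).sum / ((R m).card : ℂ)) atTop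
        (𝓝 (∫ x, g x ∂AddCircle.haarAddCircle)) := by
  have hinv : ∀ α : ℂ, c ≤ ‖α‖ → ∀ k : ℕ, ‖α⁻¹ ^ k‖ ≤ (c⁻¹) ^ k := by
    intro α hα k
    rw [norm_pow, norm_inv]
    gcongr
  have hlim : ∀ k : ℕ, Tendsto
      (fun m => ((R m).map fun α => α⁻¹ ^ (k + 1)).sum / ((R m).card : ℂ)) atTop (𝓝 0) := by
    intro k
    rw [tendsto_zero_iff_norm_tendsto_zero]
    refine ((hpow k).norm_left.tendsto_div_nhds_zero).congr fun m => ?_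
    rw [norm_div, Complex.norm_natCast]
  have hzero : ∀ n : ℤ, n ≠ 0 →
      ∫ x : AddCircle (2 * Real.pi), fourier n x ∂AddCircle.haarAddCircle = 0 := fun n hn =>
    integral_eq_zero_of_add_right_eq_neg (fourier_add_half_inv_index hn Real.two_pi_pos)
  have hone : Tendsto (fun m => ((R m).card : ℂ) / (R m).card) atTop (𝓝 1) := by
    refine tendsto_const_nhds.congr' ?_
    filter_upwards [hcard] with m hm
    rw [div_self (by exact_mod_cast hm)]
  induction hg using Submodule.span_induction with
  | mem g hg =>
    obtain ⟨n, rfl⟩ := hg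
    obtain ⟨k, rfl | rfl⟩ := n.eq_nat_or_neg
    · cases k with
      | zero =>
        refine ⟨fun _ => 1, continuousOn_const, ⟨1, fun _ _ => by simp⟩, fun x => by simp, ?_⟩
        simpa using hone
      | succ k =>
        -- This agrees with the positive power on the circle but stays bounded at infinity, and its
        -- sums are conjugates of inverse power sums.
        refine ⟨fun α => (starRingEnd ℂ) (α⁻¹ ^ (k + 1)), ?_, ⟨(c⁻¹) ^ (k + 1), fun α hα => ?_⟩,
          fun x => ?_, ?_⟩
        · exact Complex.continuous_conj.comp_continuousOn
            ((continuousOn_id.inv₀ fun _ h => h).pow _)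
        · rw [RCLike.norm_conj]; exact hinv α hα _
        · beta_reduce
          rw [fourier_apply, AddCircle.toCircle_zsmul, zpow_natCast, Circle.coe_pow, map_pow,
            ← Circle.coe_inv, Circle.coe_inv_eq_conj, Complex.conj_conj]
        · rw [hzero _ (by positivity)]
          have h := (Complex.continuous_conj.tendsto 0).comp (hlim k)
          rw [map_zero] at h
          refine h.congr fun m => ?_
          rw [Function.comp_apply, map_div₀, Complex.conj_natCast, map_multiset_sum,
            Multiset.map_map]
          rfl
    · cases k with
      | zero =>
        refine ⟨fun _ => 1, continuousOn_const, ⟨1, fun _ _ => by simp⟩, fun x => by simp, ?_⟩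
        simpa using hone
      | succ k =>
        refine ⟨fun α => α⁻¹ ^ (k + 1), (continuousOn_id.inv₀ fun _ h => h).pow _,
          ⟨(c⁻¹) ^ (k + 1), fun α hα => hinv α hα _⟩, fun x => ?_, ?_⟩
        · rw [fourier_apply, AddCircle.toCircle_zsmul, zpow_neg, zpow_natCast, ← inv_pow,
            Circle.coe_pow, Circle.coe_inv]
        · rw [hzero _ (by simp; omega)]
          exact hlim k
  | zero => exact ⟨0, continuousOn_const, ⟨0, fun _ _ => by simp⟩, fun _ => rfl, by simp⟩
  | add g₁ g₂ _ _ ih₁ ih₂ =>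
    obtain ⟨h₁, hcont₁, ⟨B₁, hB₁⟩, heq₁, hlim₁⟩ := ih₁
    obtain ⟨h₂, hcont₂, ⟨B₂, hB₂⟩, heq₂, hlim₂⟩ := ih₂
    refine ⟨fun α => h₁ α + h₂ α, hcont₁.add hcont₂,
      ⟨B₁ + B₂, fun α hα => norm_add_le_of_le (hB₁ α hα) (hB₂ α hα)⟩,
      fun x => by beta_reduce; rw [heq₁, heq₂]; rfl, ?_⟩
    simp only [ContinuousMap.add_apply]
    rw [integral_add (g₁.continuous.integrable_of_hasCompactSupport (.of_compactSpace _))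
      (g₂.continuous.integrable_of_hasCompactSupport (.of_compactSpace _))]
    refine (hlim₁.add hlim₂).congr fun m => ?_
    rw [Multiset.sum_map_add, add_div]
  | smul a g _ ih =>
    obtain ⟨h, hcont, ⟨B, hB⟩, heq, hlim⟩ := ih
    refine ⟨fun α => a * h α, continuousOn_const.mul hcont, ⟨‖a‖ * B, fun α hα => ?_⟩,
      fun x => by beta_reduce; rw [heq]; rfl, ?_⟩
    · rw [norm_mul]; exact mul_le_mul_of_nonneg_left (hB α hα) (norm_nonneg a)
    · simp only [ContinuousMap.smul_apply]
      rw [integral_smul, smul_eq_mul]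
      refine (hlim.const_mul a).congr fun m => ?_
      rw [Multiset.sum_map_mul_left, mul_div_assoc]

open Classical in
/-- Weyl's criterion for point sets concentrating near the unit circle. -/
theorem tendsto_sum_div_card_of_inv_power_sums (hc : 0 < c)
    (hR : ∀ m, ∀ α ∈ R m, c ≤ ‖α‖) (hcard : ∀ᶠ m in atTop, (R m).card ≠ 0)
    (hann : ∀ ε : ℝ, 0 < ε → (fun m => ((R m).countP (· ∈ (annulusAroundCircle ε)ᶜ) : ℝ))
      =o[atTop] fun m => ((R m).card : ℝ))
    (hpow : ∀ k : ℕ, (fun m => ((R m).map fun α => α⁻¹ ^ (k + 1)).sum)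
      =o[atTop] fun m => ((R m).card : ℝ))
    {f : ℂ → ℂ} (hf : Continuous f) {B : ℝ} (hB : ∀ α, ‖f α‖ ≤ B) :
    Tendsto (fun m => ((R m).map f).sum / ((R m).card : ℂ)) atTop
      (𝓝 (∫ x : AddCircle (2 * Real.pi), f (AddCircle.toCircle x) ∂AddCircle.haarAddCircle)) := by
  let F : C(AddCircle (2 * Real.pi), ℂ) :=
    ⟨fun x => f (AddCircle.toCircle x),
      hf.comp (continuous_subtype_val.comp AddCircle.continuous_toCircle)⟩
  rw [Metric.tendsto_nhds]
  intro δ' hδ'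
  -- The budget: 2δ for replacing f by h in the averages, δ for the limit of the averages of h, δ
  -- for the integrals of g and F.
  obtain ⟨δ, hδ, rfl⟩ : ∃ δ : ℝ, 0 < δ ∧ δ' = 4 * δ := ⟨δ' / 4, by positivity, by ring⟩
  have hF : F ∈ closure (Submodule.span ℂ (Set.range (@fourier (2 * Real.pi))) : Set _) := by
    rw [← Submodule.topologicalClosure_coe, span_fourier_closure_eq_top]
    trivial
  obtain ⟨g, hg, hFg⟩ := Metric.mem_closure_iff.1 hF δ hδ
  obtain ⟨h, hcont, ⟨B', hB'⟩, heq, hlim⟩ :=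
    exists_extension_of_mem_span_fourier hc hcard hpow hg
  have hclose : ∀ x, ‖F x - g x‖ ≤ dist F g := fun x => by
    rw [← dist_eq_norm]; exact ContinuousMap.dist_apply_le_dist x
  have hsmall := eventually_norm_sum_le_of_small_on_circle hc hR hann
    (f := fun α => f α - h α) (hf.continuousOn.sub hcont) (B := B + B')
    (fun α hα => norm_sub_le_of_le (hB α) (hB' α hα)) hδ (fun z hz => by
      obtain ⟨x, rfl⟩ := exists_toCircle_eq hz
      rw [heq]
      exact (hclose x).trans_lt hFg)
  have hint : ‖∫ x, g x ∂AddCircle.haarAddCircle - ∫ x, F x ∂AddCircle.haarAddCircle‖ ≤ δ := by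
    rw [← integral_sub (g.continuous.integrable_of_hasCompactSupport (.of_compactSpace _))
      (F.continuous.integrable_of_hasCompactSupport (.of_compactSpace _))]
    refine (norm_integral_le_of_norm_le_const (C := δ) (.of_forall fun x => ?_)).trans (by simp)
    rw [norm_sub_rev]
    exact (hclose x).trans hFg.le
  filter_upwards [hsmall, Metric.tendsto_nhds.1 hlim δ hδ, hcard] with m hm₁ hm₂ hm₃
  have hpos : (0 : ℝ) < (R m).card := by exact_mod_cast Nat.pos_of_ne_zero hm₃
  rw [dist_eq_norm] at hm₂ ⊢
  have hm₁' : ‖((R m).map f).sum / ((R m).card : ℂ) - ((R m).map h).sum / ((R m).card : ℂ)‖ ≤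
      2 * δ := by
    rw [← sub_div, ← Multiset.sum_map_sub, norm_div, Complex.norm_natCast, div_le_iff₀ hpos]
    exact hm₁
  calc _ = ‖(((R m).map f).sum / ((R m).card : ℂ) - ((R m).map h).sum / ((R m).card : ℂ)) +
        (((R m).map h).sum / ((R m).card : ℂ) - ∫ x, g x ∂AddCircle.haarAddCircle) +
        (∫ x, g x ∂AddCircle.haarAddCircle - ∫ x, F x ∂AddCircle.haarAddCircle)‖ := by
        congr 1
        change _ - (∫ x, F x ∂AddCircle.haarAddCircle) = _
        ring
    _ ≤ _ := norm_add₃_le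
    _ < 4 * δ := by linarith

end Equidistribution

/-! ### The polynomials `Ψ_m` -/

theorem zeroTotal_strictMono : StrictMono zeroTotal := by
  refine strictMono_nat_of_lt_succ fun k => ?_
  have : (k + 1) * (k + 1 + 1) = k * (k + 1) + 2 * (k + 1) := by ring
  rw [zeroTotal, zeroTotal, this]
  omega

theorem coeff_Psi (m j : ℕ) :
    (Psi m).coeff j = ∑ k ∈ Finset.range (m + 1),
      if j = zeroTotal k then (-1 : ℂ) ^ k * (2 * (k : ℂ) + 1) else 0 := by
  simp only [Psi, Polynomial.finsetSum_coeff, Polynomial.coeff_C_mul, Polynomial.coeff_X_pow,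
    mul_ite, mul_one, mul_zero, zeroTotal]
  rfl

theorem coeff_Psi_zeroTotal {m k : ℕ} (hk : k ≤ m) :
    (Psi m).coeff (zeroTotal k) = (-1 : ℂ) ^ k * (2 * (k : ℂ) + 1) := by
  rw [coeff_Psi, Finset.sum_eq_single_of_mem k (Finset.mem_range.2 (Nat.lt_succ_iff.2 hk)),
    if_pos rfl]
  intro i _ hi
  exact if_neg fun h => hi (zeroTotal_strictMono.injective h.symm)

theorem coeff_Psi_eq_zero {m j : ℕ} (hj : ∀ k ≤ m, j ≠ zeroTotal k) : (Psi m).coeff j = 0 := by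
  rw [coeff_Psi]
  exact Finset.sum_eq_zero fun k hk => if_neg (hj k (Nat.lt_succ_iff.1 (Finset.mem_range.1 hk)))

theorem norm_coeff_Psi_zeroTotal {m k : ℕ} (hk : k ≤ m) :
    ‖(Psi m).coeff (zeroTotal k)‖ = 2 * k + 1 := by
  have : (2 * (k : ℂ) + 1) = ((2 * k + 1 : ℕ) : ℂ) := by push_cast; rfl
  rw [coeff_Psi_zeroTotal hk, norm_mul, norm_pow, norm_neg, norm_one, one_pow, one_mul, this,
    Complex.norm_natCast]
  push_cast
  rfl

/-- Since k ≤ `zeroTotal k`, the factor 2k + 1 is bounded through the exponent alone, uniformly in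
m. -/
theorem norm_coeff_Psi_le (m j : ℕ) : ‖(Psi m).coeff j‖ ≤ 2 * j + 1 := by
  by_cases h : ∃ k ≤ m, j = zeroTotal k
  · obtain ⟨k, hk, rfl⟩ := h
    have : (k : ℝ) ≤ zeroTotal k := by exact_mod_cast zeroTotal_strictMono.le_apply
    rw [norm_coeff_Psi_zeroTotal hk]
    linarith
  · push Not at h
    rw [coeff_Psi_eq_zero h, norm_zero]
    positivity

theorem coeff_zero_Psi (m : ℕ) : (Psi m).coeff 0 = 1 := by
  have h := coeff_Psi_zeroTotal (Nat.zero_le m)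
  simpa [zeroTotal] using h

theorem natDegree_Psi (m : ℕ) : (Psi m).natDegree = zeroTotal m := by
  refine Polynomial.natDegree_eq_of_le_of_coeff_ne_zero ?_ ?_
  · refine Polynomial.natDegree_le_iff_coeff_eq_zero.2 fun j hj => coeff_Psi_eq_zero fun k hk => ?_
    exact ((zeroTotal_strictMono.monotone hk).trans_lt hj).ne'
  · rw [← norm_ne_zero_iff, norm_coeff_Psi_zeroTotal le_rfl]
    positivity

theorem one_le_norm_leadingCoeff_Psi (m : ℕ) : 1 ≤ ‖(Psi m).leadingCoeff‖ := by
  rw [Polynomial.leadingCoeff, natDegree_Psi, norm_coeff_Psi_zeroTotal le_rfl]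
  linarith [Nat.cast_nonneg (α := ℝ) m]

theorem card_roots_Psi (m : ℕ) : (Psi m).roots.card = zeroTotal m := by
  rw [← natDegree_Psi, (IsAlgClosed.splits (Psi m)).natDegree_eq_card_roots]

theorem tendsto_zeroTotal : Tendsto (fun m => (zeroTotal m : ℝ)) atTop atTop :=
  tendsto_natCast_atTop_atTop.comp zeroTotal_strictMono.tendsto_atTop

theorem zeroCount_eq_countP (m : ℕ) (S : Set ℂ) [DecidablePred (· ∈ S)] :
    zeroCount m S = (Psi m).roots.countP (· ∈ S) := by
  rw [zeroCount]
  congr!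

theorem isLittleO_zeroCount_compl_annulus {ε : ℝ} (hε : 0 < ε) :
    (fun m : ℕ => (zeroCount m (annulusAroundCircle ε)ᶜ : ℝ)) =o[atTop]
      (fun m : ℕ => (zeroTotal m : ℝ)) := by
  have hlog : (fun m => Real.log (2 * (zeroTotal m : ℝ) + 1)) =o[atTop]
      fun m => (zeroTotal m : ℝ) := by
    have htend : Tendsto (fun m => 2 * (zeroTotal m : ℝ) + 1) atTop atTop :=
      tendsto_atTop_add_const_right _ _ (tendsto_zeroTotal.const_mul_atTop (by norm_num))
    refine (Real.isLittleO_log_id_atTop.comp_tendsto htend).trans_isBigO ?_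
    -- 2N + 1 ≤ 3N once N ≥ 1.
    refine Asymptotics.IsBigO.of_bound 3 ?_
    filter_upwards [tendsto_zeroTotal.eventually_ge_atTop 1] with m hm
    rw [Function.comp_apply, id, Real.norm_of_nonneg (by positivity),
      Real.norm_of_nonneg (by positivity)]
    linarith
  refine Asymptotics.IsBigO.trans_isLittleO ?_ hlog
  classical
  have hpos : 0 < Real.log (1 + ε) := Real.log_pos (by linarith)
  refine Asymptotics.IsBigO.of_bound (4 / Real.log (1 + ε)) (.of_forall fun m => ?_)
  have hnn : (0 : ℝ) ≤ Real.log (2 * (zeroTotal m : ℝ) + 1) :=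
    Real.log_nonneg (by linarith [Nat.cast_nonneg (α := ℝ) (zeroTotal m)])
  rw [Real.norm_of_nonneg (by positivity), Real.norm_of_nonneg hnn, div_mul_eq_mul_div,
    le_div_iff₀ hpos, ← natDegree_Psi, zeroCount_eq_countP]
  exact countP_roots_compl_annulus_mul_log_le (coeff_zero_Psi m) (norm_coeff_Psi_le m)
    (one_le_norm_leadingCoeff_Psi m) hε

theorem tendsto_sum_roots_Psi_div {f : ℂ → ℂ} (hf : Continuous f) {B : ℝ}
    (hB : ∀ α, ‖f α‖ ≤ B) :
    Tendsto (fun m => ((Psi m).roots.map f).sum / (zeroTotal m : ℂ)) atTop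
      (𝓝 (∫ x : AddCircle (2 * Real.pi), f (AddCircle.toCircle x) ∂AddCircle.haarAddCircle)) := by
  have h := tendsto_sum_div_card_of_inv_power_sums (R := fun m => (Psi m).roots) (c := 1 / 9)
    (by norm_num)
    (fun m α hα => norm_root_ge_of_coeff_bound (coeff_zero_Psi m) (norm_coeff_Psi_le m) hα)
    ?_ ?_ ?_ hf hB
  · simpa only [card_roots_Psi] using h
  · filter_upwards [eventually_gt_atTop 0] with m hm
    rw [card_roots_Psi]
    exact (zeroTotal_strictMono.le_apply.trans_lt' hm).ne'
  · simp only [card_roots_Psi, ← zeroCount_eq_countP]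
    exact fun ε hε => isLittleO_zeroCount_compl_annulus hε
  · intro k
    simp only [card_roots_Psi]
    obtain ⟨K, hK⟩ := exists_norm_sum_inv_roots_pow_le (fun j => 2 * j + 1) k
    refine Asymptotics.IsBigO.trans_isLittleO (g := fun _ => (1 : ℝ)) ?_ ?_
    · refine Asymptotics.IsBigO.of_bound K (.of_forall fun m => ?_)
      rw [norm_one, mul_one]
      exact hK _ (coeff_zero_Psi m) (norm_coeff_Psi_le m)
    · exact (Asymptotics.isLittleO_const_left_of_ne one_ne_zero).2
        (tendsto_norm_atTop_atTop.comp tendsto_zeroTotal)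

/-! ### The zero-counting measures -/

theorem integral_sum_diracFinite (s : Multiset ℂ) (f : BoundedContinuousFunction ℂ ℝ) :
    ∫ z, f z ∂((s.map diracFinite).sum : Measure ℂ) = (s.map f).sum := by
  induction s using Multiset.induction_on with
  | empty => simp
  | cons a s ih =>
    rw [Multiset.map_cons, Multiset.sum_cons, FiniteMeasure.toMeasure_add,
      integral_add_measure (f.integrable _) (f.integrable _), ih, Multiset.map_cons,
      Multiset.sum_cons]
    congr 1
    exact integral_dirac f a

open Classical in
theorem sum_diracFinite_apply (s : Multiset ℂ) (S : Set ℂ) :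
    ((s.map diracFinite).sum : Measure ℂ) S = s.countP (· ∈ S) := by
  induction s using Multiset.induction_on with
  | empty => simp
  | cons a s ih =>
    rw [Multiset.map_cons, Multiset.sum_cons, FiniteMeasure.toMeasure_add, Measure.add_apply, ih,
      Multiset.countP_cons, add_comm]
    have : (diracFinite a : Measure ℂ) S = Set.indicator S 1 a := Measure.dirac_apply a S
    rw [this, Set.indicator_apply]
    push_cast
    rfl

theorem integral_zeroMeasure (m : ℕ) (f : BoundedContinuousFunction ℂ ℝ) :
    ∫ z, f z ∂(zeroMeasure m : Measure ℂ) = ((Psi m).roots.map f).sum / zeroTotal m := by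
  rw [zeroMeasure, FiniteMeasure.toMeasure_smul, integral_smul_nnreal_measure,
    integral_sum_diracFinite, NNReal.smul_def, smul_eq_mul, div_eq_inv_mul]
  simp

theorem toReal_zeroMeasure_apply (m : ℕ) (S : Set ℂ) :
    ((zeroMeasure m : Measure ℂ) S).toReal = zeroCount m S / zeroTotal m := by
  classical
  have : ((Psi m).roots.map diracFinite).sum.toMeasure S = zeroCount m S := by
    rw [sum_diracFinite_apply, zeroCount]
  rw [zeroMeasure, FiniteMeasure.toMeasure_smul, Measure.smul_apply, this, ENNReal.smul_def,
    smul_eq_mul, ENNReal.toReal_mul, div_eq_inv_mul]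
  simp

theorem tendsto_zeroMeasure : Tendsto zeroMeasure atTop (𝓝 circleHaar) := by
  rw [FiniteMeasure.tendsto_iff_forall_integral_tendsto]
  intro f
  have h := tendsto_sum_roots_Psi_div (f := fun z => (f z : ℂ))
    (Complex.continuous_ofReal.comp f.continuous) (B := ‖f‖)
    (fun z => by rw [Complex.norm_real]; exact f.norm_coe_le_norm z)
  rw [integral_complex_ofReal] at h
  have h' := (Complex.continuous_re.tendsto _).comp h
  rw [Complex.ofReal_re] at h'
  rw [integral_circleHaar f.continuous]
  refine h'.congr fun m => ?_
  have hsum : ((Psi m).roots.map fun z => (f z : ℂ)).sum = (((Psi m).roots.map f).sum : ℝ) := by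
    rw [← Complex.ofRealHom_eq_coe, map_multiset_sum, Multiset.map_map]
    rfl
  rw [integral_zeroMeasure, Function.comp_apply, hsum, ← Complex.ofReal_natCast,
    ← Complex.ofReal_div, Complex.ofReal_re]

instance isProbabilityMeasure_circleHaar : IsProbabilityMeasure (circleHaar : Measure ℂ) := by
  have hmeas : Measurable fun θ : ℝ => Complex.exp ((θ : ℂ) * Complex.I) := by fun_prop
  refine ⟨?_⟩
  rw [toMeasure_circleHaar, Measure.smul_apply, circleArcLength_eq_map_restrict 0,
    Measure.map_apply hmeas MeasurableSet.univ, Set.preimage_univ, Measure.restrict_apply_univ,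
    Real.volume_Ioc, smul_eq_mul, ← ENNReal.ofReal_mul (inv_nonneg.2 Real.two_pi_pos.le)]
  rw [zero_add, sub_zero, inv_mul_cancel₀ Real.two_pi_pos.ne', ENNReal.ofReal_one]

theorem isProbabilityMeasure_zeroMeasure {m : ℕ} (hm : 0 < m) :
    IsProbabilityMeasure (zeroMeasure m : Measure ℂ) := by
  have hpos : (zeroTotal m : ℝ) ≠ 0 := by
    exact_mod_cast (zeroTotal_strictMono.le_apply.trans_lt' hm).ne'
  refine ⟨?_⟩
  rw [← ENNReal.toReal_eq_one_iff, toReal_zeroMeasure_apply]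
  have : zeroCount m Set.univ = zeroTotal m := by
    classical
    rw [zeroCount_eq_countP, ← card_roots_Psi]
    exact Multiset.countP_eq_card.2 fun _ _ => trivial
  rw [this, div_self hpos]

/-! ### Sectors -/

theorem isOpen_sector {J : Set ℝ} (hJ : IsOpen J) : IsOpen (sector J) := by
  -- A sector is the image of a horizontal strip under the open map exp.
  have : sector J = Complex.exp '' (Complex.im ⁻¹' J) := by
    ext α
    constructor
    · rintro ⟨r, hr, θ, hθ, rfl⟩
      refine ⟨Real.log r + θ * Complex.I, by simpa using hθ, ?_⟩
      rw [Complex.exp_add, ← Complex.ofReal_exp, Real.exp_log hr]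
    · rintro ⟨w, hw, rfl⟩
      refine ⟨Real.exp w.re, Real.exp_pos _, w.im, hw, ?_⟩
      rw [Complex.ofReal_exp, ← Complex.exp_add, Complex.re_add_im]
  rw [this]
  exact Complex.isOpenMap_exp _ (hJ.preimage Complex.continuous_im)

theorem sector_mono {J K : Set ℝ} (h : J ⊆ K) : sector J ⊆ sector K := by
  rintro _ ⟨r, hr, θ, hθ, rfl⟩
  exact ⟨r, hr, θ, h hθ, rfl⟩

theorem exp_mem_sector {J : Set ℝ} {θ : ℝ} (hθ : θ ∈ J) :
    Complex.exp ((θ : ℂ) * Complex.I) ∈ sector J :=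
  ⟨1, one_pos, θ, hθ, by simp⟩

theorem eq_of_mul_exp_eq_mul_exp {r s θ φ : ℝ} (hr : 0 < r) (hs : 0 < s)
    (h : (r : ℂ) * Complex.exp (θ * Complex.I) = s * Complex.exp (φ * Complex.I))
    (hθφ : |θ - φ| < 2 * Real.pi) : θ = φ := by
  have hrs : r = s := by
    have := congrArg norm h
    simpa [Complex.norm_exp_ofReal_mul_I, abs_of_pos hr, abs_of_pos hs] using this
  subst hrs
  have h' := mul_left_cancel₀ (by exact_mod_cast hr.ne') h
  obtain ⟨n, hn⟩ := Complex.exp_eq_exp_iff_exists_int.1 h'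
  have hn' : θ = φ + n * (2 * Real.pi) := by
    have := congrArg Complex.im hn
    simpa using this
  have hn0 : n = 0 := by
    rw [hn', add_sub_cancel_left, abs_mul, abs_of_pos Real.two_pi_pos] at hθφ
    have h1 : |(n : ℝ)| < 1 := by
      by_contra! h1
      nlinarith [Real.two_pi_pos]
    rw [← Int.cast_abs] at h1
    exact Int.abs_lt_one_iff.1 (by exact_mod_cast h1)
  simpa [hn0] using hn'

/-- Angles from the two sets differ by less than 2π, so a common point would force them to be equal.
-/
theorem disjoint_sector {a b c : ℝ} {J : Set ℝ} (hc : c ≤ a + 2 * Real.pi)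
    (hJ : J ⊆ Set.Icc a b) : Disjoint (sector J) (sector (Set.Ioo b c)) := by
  rw [Set.disjoint_left]
  rintro _ ⟨r, hr, θ, hθ, rfl⟩ ⟨s, hs, φ, hφ, h⟩
  have hθ' := hJ hθ
  have := eq_of_mul_exp_eq_mul_exp hr hs h
    (abs_lt.2 ⟨by linarith [hθ'.1, hφ.2], by linarith [hθ'.2, hφ.1, Real.pi_pos]⟩)
  linarith [hθ'.2, hφ.1]

/-! ### Arc length of sectors and the passage to arcs -/

section ArcLength

variable {a b : ℝ} {J : Set ℝ}

theorem circleArcLength_compl_sectors (a b : ℝ) :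
    (circleArcLength : Measure ℂ)
      (sector (Set.Ioo a b) ∪ sector (Set.Ioo b (a + 2 * Real.pi)))ᶜ = 0 := by
  have hmeas : Measurable fun θ : ℝ => Complex.exp ((θ : ℂ) * Complex.I) := by fun_prop
  have hopen := (isOpen_sector (isOpen_Ioo (a := a) (b := b))).union
    (isOpen_sector (isOpen_Ioo (a := b) (b := a + 2 * Real.pi)))
  rw [circleArcLength_eq_map_restrict a, Measure.map_apply hmeas hopen.measurableSet.compl,
    Measure.restrict_apply (hmeas hopen.measurableSet.compl)]
  -- Within (a, a + 2π] only these two angles can escape both open sectors.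
  refine measure_mono_null (t := {b, a + 2 * Real.pi}) ?_ (Set.Finite.measure_zero (by simp) _)
  rintro θ ⟨hθ, h1, h2⟩
  by_contra! hne
  rw [Set.mem_insert_iff, Set.mem_singleton_iff, not_or] at hne
  rcases lt_or_gt_of_ne hne.1 with h | h
  · exact hθ (Or.inl (exp_mem_sector ⟨h1, h⟩))
  · exact hθ (Or.inr (exp_mem_sector ⟨h, lt_of_le_of_ne h2 hne.2⟩))

theorem circleArcLength_sector_Ioo (hb : b ≤ a + 2 * Real.pi) :
    (circleArcLength : Measure ℂ) (sector (Set.Ioo a b)) = ENNReal.ofReal (b - a) := by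
  have hmeas : Measurable fun θ : ℝ => Complex.exp ((θ : ℂ) * Complex.I) := by fun_prop
  have hset := (isOpen_sector (isOpen_Ioo (a := a) (b := b))).measurableSet
  rw [circleArcLength_eq_map_restrict a, Measure.map_apply hmeas hset,
    Measure.restrict_apply (hmeas hset), ← Real.volume_Ioo]
  congr 1
  ext θ
  constructor
  · rintro ⟨⟨r, hr, φ, hφ, h⟩, h1, h2⟩
    have h' : ((1 : ℝ) : ℂ) * Complex.exp (θ * Complex.I) = r * Complex.exp (φ * Complex.I) := by
      simpa using h
    rwa [eq_of_mul_exp_eq_mul_exp one_pos hr h'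
      (abs_lt.2 ⟨by linarith [hφ.2], by linarith [hφ.1]⟩)]
  · exact fun h => ⟨exp_mem_sector h, h.1, h.2.le.trans hb⟩

/-- The interior contains the open sector over (a, b), and the closure misses the open sector over
(b, a + 2π); the frontier lies in their null complement. -/
theorem circleArcLength_frontier_sector (hJ₁ : Set.Ioo a b ⊆ J) (hJ₂ : J ⊆ Set.Icc a b) :
    (circleArcLength : Measure ℂ) (frontier (sector J)) = 0 := by
  refine measure_mono_null ?_ (circleArcLength_compl_sectors a b)
  rintro z ⟨hcl, hint⟩ (hz | hz)
  · exact hint (interior_maximal (sector_mono hJ₁) (isOpen_sector isOpen_Ioo) hz)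
  · exact ((disjoint_sector le_rfl hJ₂).closure_left (isOpen_sector isOpen_Ioo)).notMem_of_mem_left
      hcl hz

theorem circleArcLength_sector (hb : b ≤ a + 2 * Real.pi)
    (hJ₁ : Set.Ioo a b ⊆ J) (hJ₂ : J ⊆ Set.Icc a b) :
    (circleArcLength : Measure ℂ) (sector J) = ENNReal.ofReal (b - a) := by
  rw [← circleArcLength_sector_Ioo hb]
  refine le_antisymm ?_ (measure_mono (sector_mono hJ₁))
  calc (circleArcLength : Measure ℂ) (sector J)
      ≤ (circleArcLength : Measure ℂ) (sector (Set.Ioo a b) ∪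
          (sector (Set.Ioo a b) ∪ sector (Set.Ioo b (a + 2 * Real.pi)))ᶜ) := by
        refine measure_mono fun z hz => ?_
        have := Set.disjoint_left.1 (disjoint_sector le_rfl hJ₂) hz
        by_cases h : z ∈ sector (Set.Ioo a b)
        · exact Or.inl h
        · exact Or.inr fun h' => h'.elim h this
    _ ≤ _ := measure_union_le _ _
    _ = _ := by rw [circleArcLength_compl_sectors a b, add_zero]

theorem tendsto_zeroCount_sector_div (hab : a ≤ b) (hb : b ≤ a + 2 * Real.pi)
    (hJ₁ : Set.Ioo a b ⊆ J) (hJ₂ : J ⊆ Set.Icc a b) :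
    Tendsto (fun m : ℕ => (zeroCount m (sector J) : ℝ) / (zeroTotal m : ℝ)) atTop
      (𝓝 ((b - a) / (2 * Real.pi))) := by
  -- The index is shifted because `zeroMeasure 0` is zero, not a probability measure.
  let μs : ℕ → ProbabilityMeasure ℂ := fun m =>
    ⟨zeroMeasure (m + 1), isProbabilityMeasure_zeroMeasure m.succ_pos⟩
  let μ : ProbabilityMeasure ℂ := ⟨circleHaar, inferInstance⟩
  have hlim : Tendsto μs atTop (𝓝 μ) := by
    rw [ProbabilityMeasure.tendsto_nhds_iff_toFiniteMeasure_tendsto_nhds]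
    exact (tendsto_add_atTop_iff_nat 1).2 tendsto_zeroMeasure
  have hnull : (μ : Measure ℂ) (frontier (sector J)) = 0 := by
    change (circleHaar : Measure ℂ) _ = 0
    rw [toMeasure_circleHaar, Measure.smul_apply, circleArcLength_frontier_sector hJ₁ hJ₂,
      smul_zero]
  have h := ProbabilityMeasure.tendsto_measure_of_null_frontier_of_tendsto' hlim hnull
  have h' := (ENNReal.tendsto_toReal (measure_ne_top (μ : Measure ℂ) (sector J))).comp h
  have hval : ((μ : Measure ℂ) (sector J)).toReal = (b - a) / (2 * Real.pi) := by
    change ((circleHaar : Measure ℂ) _).toReal = _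
    rw [toMeasure_circleHaar, Measure.smul_apply, circleArcLength_sector hb hJ₁ hJ₂,
      smul_eq_mul, ENNReal.toReal_mul, ENNReal.toReal_ofReal (inv_nonneg.2 Real.two_pi_pos.le),
      ENNReal.toReal_ofReal (sub_nonneg.2 hab), div_eq_inv_mul]
  rw [hval] at h'
  refine (tendsto_add_atTop_iff_nat 1).1 (h'.congr fun m => ?_)
  exact toReal_zeroMeasure_apply (m + 1) (sector J)

end ArcLength

/-- Equidistribution of the zeros of `Ψ_m`: the degree of `Ψ_m`, weak convergence of the normalized
zero-counting measures to `dθ / 2π`, equidistribution of the arguments in every arc (with or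
without its endpoints), and concentration of the zeros at the unit circle. -/
theorem mainTheorem3 :
    (∀ m : ℕ, (Psi m).natDegree = zeroTotal m) ∧
    Tendsto zeroMeasure atTop (𝓝 circleHaar) ∧
    (∀ (a b : ℝ) (J : Set ℝ), a ≤ b → b ≤ a + 2 * Real.pi →
      Set.Ioo a b ⊆ J → J ⊆ Set.Icc a b →
      Tendsto (fun m : ℕ => (zeroCount m (sector J) : ℝ) / (zeroTotal m : ℝ)) atTop
        (𝓝 ((b - a) / (2 * Real.pi)))) ∧
    (∀ ε : ℝ, 0 < ε →
      (fun m : ℕ => (zeroCount m (annulusAroundCircle ε)ᶜ : ℝ)) =o[atTop]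
        (fun m : ℕ => (zeroTotal m : ℝ))) := ⟨natDegree_Psi, tendsto_zeroMeasure,
    fun _ _ _ hab hb hJ₁ hJ₂ => tendsto_zeroCount_sector_div hab hb hJ₁ hJ₂,
    fun _ hε => isLittleO_zeroCount_compl_annulus hε⟩
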